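/- Let $d\ge 1$ be an integer and $\nu,\mu>0$. For $m\ge1$ and $\eta>0$, the $m$-variate Student $t$-distribution with $2\eta$ degrees of freedom is the law on $\mathbb{R}^m$ with density $$\frac{\Gamma(\eta+\frac m2)}{\Gamma(\eta)\pi^{m/2}}\,(1+\|\mathbf x\|^2)^{-\eta-\frac m2}.$$ For $r>0$ and $0<p<1$, $NB(r,p)$ is the law on $\{0,1,2,\dots\}$ with weights $\binom{k+r-1}{k}p^r(1-p)^k$. Put $$c_n^{(\nu,\mu)}=\frac{1}{B(\nu,\mu)}\frac{(\frac d2)_n}{n!}\int_0^1 t^{\mu+\frac d2-1}(1-t)^{\nu+\frac d2-1}(1-t+t^2)^n\,dt,\qquad n\ge 0,$$ where $(a)_n=a(a+1)\cdots(a+n-1)$. Let $\mathbf T_1,\mathbf T_2$ be independent $d$-variate Student $t$-vectors with $2\nu$ and $2\mu$ degrees of freedom respectively. Then the numbers $c_n^{(\nu,\mu)}$ are positive with sum $1$, and $$\mathbf T_1+\mathbf T_2\ \overset{d}{=}\ \|\mathbf T_{2N+d}\|\,\mathbf U_d ,$$ where $\mathbf U_d$ is uniformly distributed on the unit sphere of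 $\mathbb{R}^d$; for each $n\ge 0$, $\mathbf T_{2n+d}$ is a $(2n+d)$-variate Student $t$-vector with $2\nu+2\mu$ degrees of freedom; $N$ is a random variable with $\Pr\{N=n\}=c_n^{(\nu,\mu)}$ for all $n\ge0$; and, for each $n$, the variables $N$, $\mathbf T_{2n+d}$, $\mathbf U_d$ are independent. (Such variables exist, and the equality in law holds for every choice of them on a common probability space.) Moreover $N$ follows a compound negative binomial distribution $NB\left(\frac d2,t(1-t)\right)$ whose parameter $t$ is Beta-distributed with parameters $\mu$ and $\nu$; that is, the law of $N$ is the mixture of the laws $NB\left(\frac d2,t(1-t)\right)$ when $t$ has density $t^{\mu-1}(1-t)^{\nu-1}/B(\mu,\nu)$ on $(0,1)$. -/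

import Mathlib

open MeasureTheory ProbabilityTheory

noncomputable section

/-- The `d`-dimensional Euclidean space. -/
abbrev Euc (d : ℕ) : Type := EuclideanSpace ℝ (Fin d)

/-- The `d`-variate Student t-density with `2 * η` degrees of freedom,
`Γ(η + d/2) / (Γ(η) π^(d/2)) * (1 + ‖x‖²)^(-η - d/2)`. -/
def studentDensity (d : ℕ) (η : ℝ) (x : Euc d) : ℝ :=
  Real.Gamma (η + (d : ℝ) / 2) / (Real.Gamma η * Real.pi ^ ((d : ℝ) / 2)) *
    (1 + ‖x‖ ^ 2) ^ (-η - (d : ℝ) / 2)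

/-- The `d`-variate Student t-distribution with `2 * η` degrees of freedom. -/
def studentMeasure (d : ℕ) (η : ℝ) : Measure (Euc d) :=
  volume.withDensity fun x => ENNReal.ofReal (studentDensity d η x)

/-- The uniform distribution on the unit sphere of `ℝ^d`: the normalized surface measure. -/
def uniformSphere (d : ℕ) : Measure (Metric.sphere (0 : Euc d) 1) :=
  ((volume : Measure (Euc d)).toSphere Set.univ)⁻¹ • (volume : Measure (Euc d)).toSphere

/-- The coefficients
`c_n = (1 / B(ν,μ)) * (d/2)_n / n! * ∫_0^1 t^(μ+d/2-1) (1-t)^(ν+d/2-1) (1-t+t²)^n dt`,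
where `(a)_n` is the rising factorial. -/
def mixCoeff (d : ℕ) (ν μ : ℝ) (n : ℕ) : ℝ :=
  1 / beta ν μ * ((ascPochhammer ℝ n).eval ((d : ℝ) / 2) / (n.factorial : ℝ)) *
    ∫ t in (0 : ℝ)..1,
      t ^ (μ + (d : ℝ) / 2 - 1) * (1 - t) ^ (ν + (d : ℝ) / 2 - 1) * (1 - t + t ^ 2) ^ n

/-- The weights `binom(k+r-1, k) p^r (1-p)^k` of the negative binomial distribution `NB(r, p)`,
with the generalized binomial coefficient for real `r > 0`. -/
def negBinWeight (r p : ℝ) (k : ℕ) : ℝ :=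
  Ring.choose ((k : ℝ) + r - 1) k * p ^ r * (1 - p) ^ k

/-- The negative binomial distribution `NB(r, p)` on `ℕ`, for `r > 0` and `0 < p < 1`. -/
def negBinMeasure (r p : ℝ) : Measure ℕ :=
  Measure.sum fun k => ENNReal.ofReal (negBinWeight r p k) • Measure.dirac k

theorem measurable_negBinMeasure (r : ℝ) : Measurable (negBinMeasure r) := by
  refine Measure.measurable_of_measurable_coe _ fun s hs => ?_
  simp only [negBinMeasure, Measure.sum_apply _ hs, Measure.smul_apply, smul_eq_mul]
  refine Measurable.ennreal_tsum fun k => ?_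
  unfold negBinWeight
  fun_prop

/-- The compound (mixed) distribution `NB(r, p(t))` on `ℕ` whose parameter `t` is random with
law `m`: its value at `s` is `∫ NB(r, p(t))(s) dm(t)`. -/
def compoundNegBin (r : ℝ) (p : ℝ → ℝ) (m : Measure ℝ) : Measure ℕ :=
  m.bind fun t => negBinMeasure r (p t)

/-- The random variables `N`, `T n = T_{2n+d}` (`n ∈ ℕ`) and `U = U_d` on one probability space
are as in the representation: `P(N = n) = c_n^{(ν,μ)}`, `T_{2n+d}` is `(2n+d)`-variate Student t
with `2 * ν + 2 * μ` degrees of freedom, `U_d` is uniform on the unit sphere, and for every `n`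
the variables `N`, `T_{2n+d}`, `U_d` are (mutually) independent. -/
structure IsMixtureData (d : ℕ) (ν μ : ℝ) {Ω : Type*} [MeasurableSpace Ω] (P : Measure Ω)
    (N : Ω → ℕ) (T : (n : ℕ) → Ω → Euc (2 * n + d))
    (U : Ω → Metric.sphere (0 : Euc d) 1) : Prop where
  aemeasurable_index : AEMeasurable N P
  prob_index : ∀ n : ℕ, P.real {ω | N ω = n} = mixCoeff d ν μ n
  law_student : ∀ n : ℕ, HasLaw (T n) (studentMeasure (2 * n + d) (ν + μ)) P
  law_sphere : HasLaw U (uniformSphere d) P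
  indep_student_sphere : ∀ n : ℕ, IndepFun (T n) U P
  indep_index : ∀ n : ℕ, IndepFun N (fun ω => (T n ω, U ω)) P

end

/-! A Student vector is a Gaussian vector with density proportional to exp(-s‖x‖²), whose rate s is
Gamma distributed. For independent Gamma rates s₁ and s₂, the sum of the two Gaussians is again
Gaussian, with rate s₁s₂/(s₁+s₂). Writing s₁ = st and s₂ = s(1-t), with t Beta and s an independent
Gamma variable, this rate becomes s·t(1-t). Integrating s out leaves a Beta mixture over t of
Student densities rescaled by p = t(1-t) (`lconvolution_studentDensity`).

With R = ‖x‖², the identity 1 + pR = (1+R)(1 - (1-p)R/(1+R)) and the binomial series expand each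
rescaled density in the functions Rⁿ(1+R)^(-(η+d/2+n)), where η = ν+μ. Polar coordinates in
dimensions 2n+d and d show that these are, up to normalization, the densities of ‖T_{2n+d}‖U_d
(`lintegral_studentMeasure_uniformSphere`). The coefficients are then exactly the NB(d/2, p) weights
(`tsum_negBinWeight_mul_radialDensity`). Averaging them over t gives c_n, because 1-t+t² = 1-t(1-t).
-/

/-! ### Generalized binomial coefficients and the binomial series -/

theorem ringChoose_eq_ascPochhammer (a : ℝ) (n : ℕ) :
    Ring.choose ((n : ℝ) + a - 1) n = (ascPochhammer ℝ n).eval a / (n.factorial : ℝ) := by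
  rw [add_comm, ← Ring.multichoose_eq, eq_div_iff (by positivity)]
  have h := Ring.factorial_nsmul_multichoose_eq_ascPochhammer a n
  rw [nsmul_eq_mul, mul_comm, Polynomial.ascPochhammer_smeval_eq_eval] at h
  exact h

theorem ascPochhammer_eval_mul_Gamma {a : ℝ} (ha : 0 < a) (n : ℕ) :
    (ascPochhammer ℝ n).eval a * Real.Gamma a = Real.Gamma (a + n) := by
  induction n with
  | zero => simp
  | succ n ih =>
    rw [ascPochhammer_succ_eval, mul_right_comm, ih, Nat.cast_succ, ← add_assoc,
      Real.Gamma_add_one (by positivity), mul_comm]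

theorem ringChoose_eq_Gamma {a : ℝ} (ha : 0 < a) (n : ℕ) :
    Ring.choose ((n : ℝ) + a - 1) n = Real.Gamma (a + n) / (Real.Gamma a * n.factorial) := by
  rw [ringChoose_eq_ascPochhammer, ← ascPochhammer_eval_mul_Gamma ha]
  have := (Real.Gamma_pos_of_pos ha).ne'
  field_simp

theorem ringChoose_pos {a : ℝ} (ha : 0 < a) (n : ℕ) :
    0 < Ring.choose ((n : ℝ) + a - 1) n := by
  rw [ringChoose_eq_ascPochhammer]
  exact div_pos (ascPochhammer_pos n a ha) (by positivity)

theorem hasSum_ringChoose_mul_pow (a : ℝ) {x : ℝ} (hx : |x| < 1) :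
    HasSum (fun n : ℕ => Ring.choose ((n : ℝ) + a - 1) n * x ^ n) ((1 - x) ^ (-a)) := by
  have h := (Real.one_div_one_sub_rpow_hasFPowerSeriesOnBall_zero a).hasSum (y := x)
    (by simpa [enorm_eq_nnnorm] using! hx)
  have h1 : 0 ≤ 1 - x := by linarith [(abs_lt.1 hx).2]
  simpa [FormalMultilinearSeries.ofScalars_apply_eq, Real.rpow_neg h1, add_comm, mul_comm] using h

theorem tsum_ofReal_ringChoose_mul_pow {a x : ℝ} (ha : 0 < a) (h0 : 0 ≤ x) (h1 : x < 1) :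
    ∑' n : ℕ, ENNReal.ofReal (Ring.choose ((n : ℝ) + a - 1) n * x ^ n) =
      ENNReal.ofReal ((1 - x) ^ (-a)) := by
  have h := hasSum_ringChoose_mul_pow a (x := x) (by rwa [abs_of_nonneg h0])
  rw [← h.tsum_eq, ENNReal.ofReal_tsum_of_nonneg _ h.summable]
  exact fun n => mul_nonneg (ringChoose_pos ha n).le (by positivity)

/-! ### Gaussian densities and their Gamma mixtures -/

/-- The density `(s / π) ^ (d / 2) * exp (-s * ‖x‖²)` of a centred Gaussian vector. -/
noncomputable def gaussDensity (d : ℕ) (s : ℝ) (x : Euc d) : ℝ :=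
  (s / Real.pi) ^ ((d : ℝ) / 2) * Real.exp (-s * ‖x‖ ^ 2)

theorem gaussDensity_nonneg (d : ℕ) {s : ℝ} (hs : 0 ≤ s) (x : Euc d) : 0 ≤ gaussDensity d s x := by
  unfold gaussDensity; positivity

theorem measurable_gaussDensity (d : ℕ) :
    Measurable fun p : ℝ × Euc d => gaussDensity d p.1 p.2 := by
  unfold gaussDensity; fun_prop

theorem lintegral_gaussDensity (d : ℕ) {s : ℝ} (hs : 0 < s) :
    ∫⁻ x : Euc d, ENNReal.ofReal (gaussDensity d s x) = 1 := by
  have h := GaussianFourier.integral_rexp_neg_mul_sq_norm (V := Euc d) hs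
  rw [finrank_euclideanSpace_fin] at h
  have hpos : 0 < (Real.pi / s) ^ ((d : ℝ) / 2) := by positivity
  have hi : Integrable fun x : Euc d => Real.exp (-s * ‖x‖ ^ 2) := by
    -- The integral of a non-integrable function is 0 by convention, so the positive value in `h`
    -- forces integrability.
    by_contra hc
    rw [integral_undef hc] at h
    exact hpos.ne h
  unfold gaussDensity
  rw [← ofReal_integral_eq_lintegral_ofReal (hi.const_mul _)
    (Filter.Eventually.of_forall fun x => by positivity), integral_const_mul, h,
    ← Real.mul_rpow (by positivity) (by positivity)]
  have : s / Real.pi * (Real.pi / s) = 1 := by have := Real.pi_pos; field_simp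
  simp [this]

/-- Completing the square in `y`: the exponent is minimal at `(t / (s + t)) • x`. Only the second
factor on the right depends on `y`, and it integrates to 1. -/
theorem gaussDensity_mul_gaussDensity_sub (d : ℕ) {s t : ℝ} (hs : 0 < s) (ht : 0 < t)
    (x y : Euc d) :
    gaussDensity d s y * gaussDensity d t (-y + x) =
      gaussDensity d (s * t / (s + t)) x * gaussDensity d (s + t) (y - (t / (s + t)) • x) := by
  have hst : s + t ≠ 0 := by positivity
  have e1 : ‖-y + x‖ ^ 2 = ‖y‖ ^ 2 - 2 * inner ℝ y x + ‖x‖ ^ 2 := by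
    rw [neg_add_eq_sub, norm_sub_rev, norm_sub_sq_real]
  have e2 : ‖y - (t / (s + t)) • x‖ ^ 2 =
      ‖y‖ ^ 2 - 2 * (t / (s + t)) * inner ℝ y x + (t / (s + t)) ^ 2 * ‖x‖ ^ 2 := by
    rw [norm_sub_sq_real, real_inner_smul_right, norm_smul, mul_pow, Real.norm_eq_abs, sq_abs]
    ring
  unfold gaussDensity
  rw [mul_mul_mul_comm, mul_mul_mul_comm ((s * t / (s + t) / Real.pi) ^ ((d : ℝ) / 2)),
    ← Real.exp_add, ← Real.exp_add, ← Real.mul_rpow (by positivity) (by positivity),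
    ← Real.mul_rpow (by positivity) (by positivity), e1, e2]
  congr 2
  · field_simp
  · field_simp
    ring

/-- The convolution of two centred Gaussian densities is a centred Gaussian density. -/
theorem lintegral_gaussDensity_mul_gaussDensity (d : ℕ) {s t : ℝ} (hs : 0 < s) (ht : 0 < t)
    (x : Euc d) :
    ∫⁻ y : Euc d, ENNReal.ofReal (gaussDensity d s y) * ENNReal.ofReal (gaussDensity d t (-y + x)) =
      ENNReal.ofReal (gaussDensity d (s * t / (s + t)) x) := by
  have hst : 0 < s + t := by positivity
  simp_rw [← ENNReal.ofReal_mul (gaussDensity_nonneg d hs.le _),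
    gaussDensity_mul_gaussDensity_sub d hs ht,
    ENNReal.ofReal_mul (gaussDensity_nonneg d (show 0 ≤ s * t / (s + t) by positivity) x)]
  rw [lintegral_const_mul' _ _ ENNReal.ofReal_ne_top,
    lintegral_sub_right_eq_self (fun y => ENNReal.ofReal (gaussDensity d (s + t) y)),
    lintegral_gaussDensity d hst, mul_one]

/-- A Gamma mixture of Gaussian densities is a Student t-type density. -/
theorem lintegral_gammaPDF_mul_gaussDensity (d : ℕ) {η k : ℝ} (hη : 0 < η) (hk : 0 < k)
    (x : Euc d) :
    ∫⁻ s, gammaPDF η 1 s * ENNReal.ofReal (gaussDensity d (s * k) x) =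
      ENNReal.ofReal (Real.Gamma (η + (d : ℝ) / 2) / (Real.Gamma η * Real.pi ^ ((d : ℝ) / 2)) *
        (k ^ ((d : ℝ) / 2) * (1 + k * ‖x‖ ^ 2) ^ (-η - (d : ℝ) / 2))) := by
  set h : ℝ := (d : ℝ) / 2 with hh
  have hh0 : 0 ≤ h := by positivity
  have hr : 0 < 1 + k * ‖x‖ ^ 2 := by positivity
  have hG := Real.Gamma_pos_of_pos hη
  have hG' := Real.Gamma_pos_of_pos (show 0 < η + h by positivity)
  -- The factor 1 is written as the total mass of the Gamma density of shape η + d/2 and rate 1 +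
  -- k‖x‖², so that the two integrands agree pointwise away from `s = 0`.
  rw [← mul_one (ENNReal.ofReal _), ← lintegral_gammaPDF_eq_one (show 0 < η + h by positivity) hr,
    ← lintegral_const_mul' _ _ ENNReal.ofReal_ne_top]
  refine lintegral_congr_ae ?_
  filter_upwards [Measure.ae_ne volume 0] with s hs0
  rcases lt_or_gt_of_ne hs0 with hs | hs
  · simp [gammaPDF_of_neg hs]
  rw [gammaPDF_of_nonneg hs.le, gammaPDF_of_nonneg hs.le, ← ENNReal.ofReal_mul (by positivity),
    ← ENNReal.ofReal_mul (by positivity)]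
  congr 1
  unfold gaussDensity
  rw [← hh, Real.div_rpow (by positivity) (by positivity), Real.mul_rpow hs.le hk.le,
    show -η - h = -(η + h) by ring, Real.rpow_neg hr.le,
    show η + h - 1 = (η - 1) + h by ring, Real.rpow_add hs,
    show -((1 + k * ‖x‖ ^ 2) * s) = -(1 * s) + -(s * k) * ‖x‖ ^ 2 by ring, Real.exp_add,
    Real.one_rpow]
  have := Real.rpow_pos_of_pos hr (η + h)
  field_simp

theorem measurable_studentDensity (d : ℕ) (η : ℝ) : Measurable (studentDensity d η) := by
  unfold studentDensity; fun_prop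

theorem ofReal_studentDensity (d : ℕ) {η : ℝ} (hη : 0 < η) (x : Euc d) :
    ENNReal.ofReal (studentDensity d η x) =
      ∫⁻ s, gammaPDF η 1 s * ENNReal.ofReal (gaussDensity d s x) := by
  have h := lintegral_gammaPDF_mul_gaussDensity d hη one_pos x
  simp only [mul_one, one_mul, Real.one_rpow] at h
  rw [h]; rfl

theorem measurable_gammaPDF (a r : ℝ) : Measurable (gammaPDF a r) :=
  (measurable_gammaPDFReal a r).ennreal_ofReal

theorem isProbabilityMeasure_studentMeasure (d : ℕ) {η : ℝ} (hη : 0 < η) :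
    IsProbabilityMeasure (studentMeasure d η) := by
  refine ⟨?_⟩
  have hm := measurable_gaussDensity d
  have hg := measurable_gammaPDF η 1
  rw [studentMeasure, withDensity_apply _ MeasurableSet.univ, Measure.restrict_univ]
  simp_rw [ofReal_studentDensity d hη]
  rw [lintegral_lintegral_swap (by fun_prop), ← lintegral_gammaPDF_eq_one hη one_pos]
  refine lintegral_congr_ae ?_
  filter_upwards [Measure.ae_ne volume 0] with s hs0
  rcases lt_or_gt_of_ne hs0 with hs | hs
  · simp [gammaPDF_of_neg hs]
  rw [lintegral_const_mul _ (by fun_prop), lintegral_gaussDensity d hs, mul_one]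

/-! ### Beta–Gamma algebra -/

theorem lintegral_eq_abs_mul_lintegral_comp_mul {s : ℝ} (hs : s ≠ 0) {H : ℝ → ENNReal}
    (hH : Measurable H) : ∫⁻ x, H x = ENNReal.ofReal |s| * ∫⁻ t, H (s * t) := by
  conv_lhs => rw [← Real.smul_map_volume_mul_left hs]
  rw [lintegral_smul_measure, lintegral_map hH (by fun_prop), smul_eq_mul]

/-- The factor `|s|` is the Jacobian of (s, t) ↦ (st, s(1-t)). Unless s > 0 and 0 < t < 1, one of st
and s(1-t) is negative and both sides vanish; the excluded values form a null set. -/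
theorem gammaPDF_mul_gammaPDF_mul {a b : ℝ} (ha : 0 < a) (hb : 0 < b) {s t : ℝ} (hs : s ≠ 0)
    (ht0 : t ≠ 0) (ht1 : t ≠ 1) :
    ENNReal.ofReal |s| * (gammaPDF a 1 (s * t) * gammaPDF b 1 (s * (1 - t))) =
      betaPDF a b t * gammaPDF (a + b) 1 s := by
  rcases lt_or_gt_of_ne hs with hs | hs
  · rw [gammaPDF_of_neg hs]
    rcases lt_or_gt_of_ne ht0 with ht0 | ht0
    · rw [gammaPDF_of_neg (show s * (1 - t) < 0 by nlinarith)]; simp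
    · rw [gammaPDF_of_neg (show s * t < 0 by nlinarith)]; simp
  rcases lt_or_gt_of_ne ht0 with ht0 | ht0
  · rw [gammaPDF_of_neg (show s * t < 0 by nlinarith), betaPDF_eq_zero_of_nonpos ht0.le]; simp
  rcases lt_or_gt_of_ne ht1 with ht1 | ht1
  swap
  · rw [gammaPDF_of_neg (show s * (1 - t) < 0 by nlinarith), betaPDF_eq_zero_of_one_le ht1.le]
    simp
  have h1t : 0 < 1 - t := by linarith
  have hGa := Real.Gamma_pos_of_pos ha
  have hGb := Real.Gamma_pos_of_pos hb
  have hGab := Real.Gamma_pos_of_pos (add_pos ha hb)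
  rw [gammaPDF_of_nonneg (by positivity), gammaPDF_of_nonneg (by positivity),
    gammaPDF_of_nonneg hs.le, betaPDF_of_pos_lt_one ht0 ht1, abs_of_pos hs,
    ← ENNReal.ofReal_mul (by positivity), ← ENNReal.ofReal_mul (by positivity),
    ← ENNReal.ofReal_mul (by have := beta_pos ha hb; positivity)]
  congr 1
  rw [beta, Real.mul_rpow hs.le ht0.le, Real.mul_rpow hs.le h1t.le,
    show a + b - 1 = (a - 1) + (b - 1) + 1 by ring, Real.rpow_add_one hs.ne', Real.rpow_add hs,
    show -(1 * s) = -(1 * (s * t)) + -(1 * (s * (1 - t))) by ring, Real.exp_add]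
  simp only [Real.one_rpow]
  field_simp

theorem measurable_betaPDF (a b : ℝ) : Measurable (betaPDF a b) :=
  (measurable_betaPDFReal a b).ennreal_ofReal

/-- Two independent Gamma variables are `(s * t, s * (1 - t))` with `t` Beta distributed and `s`
an independent Gamma variable. -/
theorem lintegral_gammaPDF_gammaPDF {a b : ℝ} (ha : 0 < a) (hb : 0 < b) {F : ℝ → ℝ → ENNReal}
    (hF : Measurable F.uncurry) :
    ∫⁻ s₁, ∫⁻ s₂, gammaPDF a 1 s₁ * gammaPDF b 1 s₂ * F s₁ s₂ =
      ∫⁻ t, betaPDF a b t * ∫⁻ s, gammaPDF (a + b) 1 s * F (s * t) (s * (1 - t)) := by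
  have hga := measurable_gammaPDF a 1
  have hgb := measurable_gammaPDF b 1
  have hgab := measurable_gammaPDF (a + b) 1
  have hbt := measurable_betaPDF a b
  have hFm : ∀ {f g : ℝ × ℝ → ℝ}, Measurable f → Measurable g →
      Measurable fun p => F (f p) (g p) := fun hf hg => hF.comp (hf.prodMk hg)
  have hFm' : ∀ {f g : ℝ → ℝ}, Measurable f → Measurable g →
      Measurable fun p => F (f p) (g p) := fun hf hg => hF.comp (hf.prodMk hg)
  have m1 : Measurable fun p : ℝ × ℝ =>
      gammaPDF a 1 p.1 * gammaPDF b 1 (p.2 - p.1) * F p.1 (p.2 - p.1) :=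
    ((hga.comp measurable_fst).mul (hgb.comp (measurable_snd.sub measurable_fst))).mul
      (hFm measurable_fst (measurable_snd.sub measurable_fst))
  have m2 : Measurable fun p : ℝ × ℝ =>
      betaPDF a b p.2 * (gammaPDF (a + b) 1 p.1 * F (p.1 * p.2) (p.1 * (1 - p.2))) :=
    (hbt.comp measurable_snd).mul ((hgab.comp measurable_fst).mul
      (hFm (by fun_prop) (by fun_prop)))
  -- The change of variables is done one coordinate at a time: the shift s₂ = s - s₁ at fixed s₁,
  -- then the scaling s₁ = st at fixed s.
  calc _ = ∫⁻ s₁, ∫⁻ s, gammaPDF a 1 s₁ * gammaPDF b 1 (s - s₁) * F s₁ (s - s₁) :=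
        lintegral_congr fun s₁ => (lintegral_sub_right_eq_self
          (fun s₂ => gammaPDF a 1 s₁ * gammaPDF b 1 s₂ * F s₁ s₂) s₁).symm
    _ = ∫⁻ s, ∫⁻ s₁, gammaPDF a 1 s₁ * gammaPDF b 1 (s - s₁) * F s₁ (s - s₁) :=
        lintegral_lintegral_swap m1.aemeasurable
    _ = ∫⁻ s, ∫⁻ t, betaPDF a b t * (gammaPDF (a + b) 1 s * F (s * t) (s * (1 - t))) := by
        refine lintegral_congr_ae ?_
        filter_upwards [Measure.ae_ne volume 0] with s hs
        have m3 : Measurable fun s₁ =>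
            gammaPDF a 1 s₁ * gammaPDF b 1 (s - s₁) * F s₁ (s - s₁) :=
          m1.comp (measurable_id.prodMk measurable_const)
        rw [lintegral_eq_abs_mul_lintegral_comp_mul hs m3,
          ← lintegral_const_mul' _ _ ENNReal.ofReal_ne_top]
        refine lintegral_congr_ae ?_
        filter_upwards [Measure.ae_ne volume 0, Measure.ae_ne volume 1] with t ht0 ht1
        rw [show s - s * t = s * (1 - t) by ring, ← mul_assoc,
          gammaPDF_mul_gammaPDF_mul ha hb hs ht0 ht1, mul_assoc]
    _ = ∫⁻ t, ∫⁻ s, betaPDF a b t * (gammaPDF (a + b) 1 s * F (s * t) (s * (1 - t))) :=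
        lintegral_lintegral_swap m2.aemeasurable
    _ = _ := lintegral_congr fun t =>
        lintegral_const_mul _ (hgab.mul (hFm' (by fun_prop) (by fun_prop)))

/-! ### Convolution of two Student densities -/

theorem lconvolution_studentDensity (d : ℕ) {η θ : ℝ} (hη : 0 < η) (hθ : 0 < θ) (x : Euc d) :
    lconvolution (fun x : Euc d => ENNReal.ofReal (studentDensity d η x))
      (fun x => ENNReal.ofReal (studentDensity d θ x)) volume x =
    ∫⁻ t, betaPDF η θ t * ENNReal.ofReal
      (Real.Gamma (η + θ + (d : ℝ) / 2) / (Real.Gamma (η + θ) * Real.pi ^ ((d : ℝ) / 2)) *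
        ((t * (1 - t)) ^ ((d : ℝ) / 2) *
          (1 + t * (1 - t) * ‖x‖ ^ 2) ^ (-(η + θ) - (d : ℝ) / 2))) := by
  have hη' := measurable_gammaPDF η 1
  have hθ' := measurable_gammaPDF θ 1
  have hG := measurable_gaussDensity d
  have mG : ∀ {α : Type} [MeasurableSpace α] {f : α → ℝ} {g : α → Euc d}, Measurable f →
      Measurable g → Measurable fun p => ENNReal.ofReal (gaussDensity d (f p) (g p)) :=
    fun hf hg => (hG.comp (hf.prodMk hg)).ennreal_ofReal
  have mG1 (y : Euc d) : Measurable fun s => ENNReal.ofReal (gaussDensity d s y) :=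
    mG measurable_id measurable_const
  have mG2 (s : ℝ) : Measurable fun y => ENNReal.ofReal (gaussDensity d s y) :=
    mG measurable_const measurable_id
  have mG3 (s : ℝ) : Measurable fun y => ENNReal.ofReal (gaussDensity d s (-y + x)) :=
    mG measurable_const (by fun_prop)
  rw [lconvolution_def]
  calc _ = ∫⁻ y : Euc d, ∫⁻ s₁, ∫⁻ s₂, (gammaPDF η 1 s₁ * gammaPDF θ 1 s₂) *
        (ENNReal.ofReal (gaussDensity d s₁ y) * ENNReal.ofReal (gaussDensity d s₂ (-y + x))) := by
        refine lintegral_congr fun y => ?_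
        rw [ofReal_studentDensity d hη, ofReal_studentDensity d hθ,
          ← lintegral_mul_const _ (by exact hη'.mul (mG1 y))]
        refine lintegral_congr fun s₁ => ?_
        rw [← lintegral_const_mul _ (by exact hθ'.mul (mG1 (-y + x)))]
        exact lintegral_congr fun s₂ => mul_mul_mul_comm _ _ _ _
    _ = ∫⁻ s₁, ∫⁻ s₂, ∫⁻ y : Euc d, (gammaPDF η 1 s₁ * gammaPDF θ 1 s₂) *
        (ENNReal.ofReal (gaussDensity d s₁ y) * ENNReal.ofReal (gaussDensity d s₂ (-y + x))) := by
        rw [lintegral_lintegral_swap]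
        · refine lintegral_congr fun s₁ => lintegral_lintegral_swap (Measurable.aemeasurable ?_)
          exact (measurable_const.mul (hθ'.comp measurable_snd)).mul
            (((mG2 s₁).comp measurable_fst).mul (mG (by fun_prop) (by fun_prop)))
        · refine (Measurable.lintegral_prod_right ?_).aemeasurable
          exact ((hη'.comp (by fun_prop)).mul (hθ'.comp measurable_snd)).mul
            ((mG (by fun_prop) (by fun_prop)).mul (mG (by fun_prop) (by fun_prop)))
    _ = ∫⁻ s₁, ∫⁻ s₂, gammaPDF η 1 s₁ * gammaPDF θ 1 s₂ *
          ENNReal.ofReal (gaussDensity d (s₁ * s₂ / (s₁ + s₂)) x) := by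
        refine lintegral_congr_ae ?_
        filter_upwards [Measure.ae_ne volume 0] with s₁ h₁
        refine lintegral_congr_ae ?_
        filter_upwards [Measure.ae_ne volume 0] with s₂ h₂
        rw [lintegral_const_mul _ (by exact (mG2 s₁).mul (mG3 s₂))]
        rcases lt_or_gt_of_ne h₁ with h₁ | h₁
        · simp [gammaPDF_of_neg h₁]
        rcases lt_or_gt_of_ne h₂ with h₂ | h₂
        · simp [gammaPDF_of_neg h₂]
        rw [lintegral_gaussDensity_mul_gaussDensity d h₁ h₂]
    _ = ∫⁻ t, betaPDF η θ t * ∫⁻ s, gammaPDF (η + θ) 1 s *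
          ENNReal.ofReal (gaussDensity d (s * t * (s * (1 - t)) / (s * t + s * (1 - t))) x) :=
        lintegral_gammaPDF_gammaPDF hη hθ (F := fun s₁ s₂ =>
          ENNReal.ofReal (gaussDensity d (s₁ * s₂ / (s₁ + s₂)) x)) ((mG1 x).comp (by fun_prop))
    _ = _ := by
        refine lintegral_congr fun t => ?_
        rcases le_or_gt t 0 with ht0 | ht0
        · simp [betaPDF_eq_zero_of_nonpos ht0]
        rcases le_or_gt 1 t with ht1 | ht1
        · simp [betaPDF_eq_zero_of_one_le ht1]
        rw [← lintegral_gammaPDF_mul_gaussDensity d (add_pos hη hθ)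
          (mul_pos ht0 (sub_pos.2 ht1)) x]
        congr 1
        refine lintegral_congr fun s => ?_
        -- At `s = 0` the quotient is 0/0, which is 0 by convention and agrees with `s * (t * (1 -
        -- t))`.
        rcases eq_or_ne s 0 with rfl | hs
        · simp
        rw [show s * t * (s * (1 - t)) / (s * t + s * (1 - t)) = s * (t * (1 - t)) by
          rw [show s * t + s * (1 - t) = s by ring]; field_simp]

/-! ### Polar coordinates and the law of ‖T‖U -/

/-- Integration in polar coordinates. -/
theorem lintegral_eq_lintegral_toSphere {d : ℕ} (hd : 0 < d) {φ : Euc d → ENNReal}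
    (hφ : Measurable φ) :
    ∫⁻ x, φ x = ∫⁻ u, (∫⁻ r in Set.Ioi (0 : ℝ),
      ENNReal.ofReal (r ^ (d - 1)) * φ (r • (u : Euc d)))
      ∂(volume : Measure (Euc d)).toSphere := by
  have : NeZero d := ⟨hd.ne'⟩
  have hmp := (volume : Measure (Euc d)).measurePreserving_homeomorphUnitSphereProd
  have hm : Measurable fun p : Metric.sphere (0 : Euc d) 1 × Set.Ioi (0 : ℝ) =>
      φ ((p.2 : ℝ) • (p.1 : Euc d)) := by fun_prop
  calc ∫⁻ x, φ x = ∫⁻ x : ({(0 : Euc d)}ᶜ : Set (Euc d)), φ x ∂(volume.comap Subtype.val) := by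
        rw [lintegral_subtype_comap (measurableSet_singleton _).compl, restrict_compl_singleton]
    _ = ∫⁻ p, φ ((p.2 : ℝ) • (p.1 : Euc d))
          ∂((volume : Measure (Euc d)).toSphere.prod (.volumeIoiPow (d - 1))) := by
        rw [finrank_euclideanSpace_fin] at hmp
        rw [← hmp.lintegral_comp hm]
        refine lintegral_congr fun x => ?_
        have hx : ‖(x : Euc d)‖ ≠ 0 := norm_ne_zero_iff.2 x.2
        simp [smul_smul, hx]
    _ = _ := by
        rw [lintegral_prod _ hm.aemeasurable]
        refine lintegral_congr fun u => ?_
        rw [Measure.volumeIoiPow, lintegral_withDensity_eq_lintegral_mul _ (by fun_prop)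
          (by fun_prop)]
        exact lintegral_subtype_comap measurableSet_Ioi
          fun r => ENNReal.ofReal (r ^ (d - 1)) * φ (r • (u : Euc d))

theorem toSphere_volume_univ {d : ℕ} (hd : 0 < d) :
    (volume : Measure (Euc d)).toSphere Set.univ =
      ENNReal.ofReal (2 * Real.pi ^ ((d : ℝ) / 2) / Real.Gamma ((d : ℝ) / 2)) := by
  have : NeZero d := ⟨hd.ne'⟩
  have hd' : (0 : ℝ) < d := by exact_mod_cast hd
  rw [Measure.toSphere_apply_univ, EuclideanSpace.volume_ball, finrank_euclideanSpace_fin,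
    Fintype.card_fin, ENNReal.ofReal_one, one_pow, one_mul, ← ENNReal.ofReal_natCast,
    ← ENNReal.ofReal_mul hd'.le, Real.Gamma_add_one (by positivity), Real.sqrt_eq_rpow,
    ← Real.rpow_natCast, ← Real.rpow_mul Real.pi_pos.le]
  have := Real.Gamma_pos_of_pos (show 0 < (d : ℝ) / 2 by positivity)
  congr 1
  rw [show 1 / 2 * (d : ℝ) = d / 2 by ring]
  field_simp

theorem isProbabilityMeasure_uniformSphere {d : ℕ} (hd : 0 < d) :
    IsProbabilityMeasure (uniformSphere d) := by
  have hd' : (0 : ℝ) < d := by exact_mod_cast hd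
  have := Real.Gamma_pos_of_pos (show 0 < (d : ℝ) / 2 by positivity)
  have hpos : 0 < 2 * Real.pi ^ ((d : ℝ) / 2) / Real.Gamma ((d : ℝ) / 2) := by positivity
  refine ⟨?_⟩
  rw [uniformSphere, Measure.smul_apply, smul_eq_mul, toSphere_volume_univ hd]
  exact ENNReal.inv_mul_cancel (by simpa using hpos) ENNReal.ofReal_ne_top

/-- The density of `‖T‖ • U`, for `T` a `(2 * n + d)`-variate Student t-vector with `2 * η` degrees
of freedom and `U` independent of `T` and uniform on the unit sphere of `ℝ^d`. -/
noncomputable def radialDensity (d n : ℕ) (η : ℝ) (x : Euc d) : ℝ :=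
  Real.Gamma ((d : ℝ) / 2) * Real.Gamma (η + (d : ℝ) / 2 + n) /
    (Real.Gamma ((d : ℝ) / 2 + n) * (Real.Gamma η * Real.pi ^ ((d : ℝ) / 2))) *
      ((‖x‖ ^ 2) ^ n * (1 + ‖x‖ ^ 2) ^ (-(η + (d : ℝ) / 2 + n)))

theorem measurable_radialDensity (d n : ℕ) (η : ℝ) : Measurable (radialDensity d n η) := by
  unfold radialDensity; fun_prop

/-- The radial weight in dimension 2n+d factors as r^(d-1)·r^(2n). The first factor is the radial
weight in dimension d, so the integral can be read back over ℝ^d with an extra ‖x‖^(2n). The ratio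
of the two sphere areas supplies Γ(d/2)/Γ(d/2+n) and πⁿ. -/
theorem lintegral_studentMeasure_uniformSphere {d : ℕ} (hd : 0 < d) (n : ℕ) {η : ℝ} (hη : 0 < η)
    {φ : Euc d → ENNReal} (hφ : Measurable φ) :
    ∫⁻ y, ∫⁻ u, φ (‖y‖ • (u : Euc d)) ∂(uniformSphere d) ∂(studentMeasure (2 * n + d) η) =
      ∫⁻ x, ENNReal.ofReal (radialDensity d n η x) * φ x := by
  have hd' : (0 : ℝ) < d := by exact_mod_cast hd
  have hm : 0 < 2 * n + d := by omega
  have hGd := Real.Gamma_pos_of_pos (show 0 < (d : ℝ) / 2 by positivity)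
  have hGn := Real.Gamma_pos_of_pos (show 0 < (d : ℝ) / 2 + n by positivity)
  have hGη := Real.Gamma_pos_of_pos hη
  have hGηn := Real.Gamma_pos_of_pos (show 0 < η + (d : ℝ) / 2 + n by positivity)
  set K : ℝ := Real.Gamma (η + (d : ℝ) / 2 + n) / (Real.Gamma η * Real.pi ^ ((d : ℝ) / 2 + n))
    with hK
  have hK0 : 0 < K := by positivity
  set q : ℝ → ℝ := fun r => K * (1 + r ^ 2) ^ (-(η + (d : ℝ) / 2 + n)) with hq
  have hqm : Measurable q := by fun_prop
  have hcast : ((2 * n + d : ℕ) : ℝ) / 2 = (d : ℝ) / 2 + n := by push_cast; ring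
  have hstud (y : Euc (2 * n + d)) : studentDensity (2 * n + d) η y = q ‖y‖ := by
    rw [studentDensity, hcast, hq, hK]
    simp only
    rw [show -η - ((d : ℝ) / 2 + n) = -(η + (d : ℝ) / 2 + n) by ring, ← add_assoc]
  set σ := (volume : Measure (Euc d)).toSphere with hσ
  set σ' := (volume : Measure (Euc (2 * n + d))).toSphere with hσ'
  set ψ : ℝ → ENNReal := fun r => ∫⁻ u, φ (r • (u : Euc d)) ∂σ with hψ
  have hφm : Measurable fun p : ℝ × Metric.sphere (0 : Euc d) 1 => φ (p.1 • (p.2 : Euc d)) := by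
    fun_prop
  have hψm : Measurable ψ := hφm.lintegral_prod_right'
  have hψm' : Measurable fun y : Euc (2 * n + d) => ψ ‖y‖ := hψm.comp measurable_norm
  calc _ = ∫⁻ y : Euc (2 * n + d), ENNReal.ofReal (q ‖y‖) * ((σ Set.univ)⁻¹ * ψ ‖y‖) := by
        simp only [uniformSphere, lintegral_smul_measure, smul_eq_mul]
        rw [studentMeasure, lintegral_withDensity_eq_lintegral_mul _
          (measurable_studentDensity _ _).ennreal_ofReal (by exact hψm'.const_mul _)]
        simp only [Pi.mul_apply, hstud]
        rfl
    _ = ∫⁻ _, (∫⁻ r in Set.Ioi (0 : ℝ), ENNReal.ofReal (r ^ (2 * n + d - 1)) *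
          (ENNReal.ofReal (q r) * ((σ Set.univ)⁻¹ * ψ r))) ∂σ' := by
        rw [lintegral_eq_lintegral_toSphere hm (by exact
          (hqm.comp measurable_norm).ennreal_ofReal.mul (hψm'.const_mul _))]
        refine lintegral_congr fun u => setLIntegral_congr_fun measurableSet_Ioi fun r hr => ?_
        have hr : 0 < r := hr
        simp [norm_smul, abs_of_pos hr]
    _ = σ' Set.univ * (σ Set.univ)⁻¹ * ∫⁻ r in Set.Ioi (0 : ℝ), ∫⁻ u,
          ENNReal.ofReal (r ^ (d - 1)) *
            (ENNReal.ofReal (r ^ (2 * n) * q r) * φ (r • (u : Euc d))) ∂σ := by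
        have hσne : (σ Set.univ)⁻¹ ≠ ⊤ := by
          rw [hσ, toSphere_volume_univ hd]
          exact ENNReal.inv_ne_top.2 (ENNReal.ofReal_pos.2 (by positivity)).ne'
        rw [lintegral_const, mul_comm, mul_assoc, ← lintegral_const_mul' _ _ hσne]
        congr 1
        refine setLIntegral_congr_fun measurableSet_Ioi fun r hr => ?_
        have hr : 0 < r := hr
        rw [lintegral_const_mul' _ _ ENNReal.ofReal_ne_top,
          lintegral_const_mul' _ _ ENNReal.ofReal_ne_top,
          show 2 * n + d - 1 = (d - 1) + 2 * n by omega, pow_add,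
          ENNReal.ofReal_mul (p := r ^ (d - 1)) (by positivity),
          ENNReal.ofReal_mul (p := r ^ (2 * n)) (by positivity)]
        simp only [hψ]
        ring
    _ = σ' Set.univ * (σ Set.univ)⁻¹ * ∫⁻ x : Euc d,
          ENNReal.ofReal (‖x‖ ^ (2 * n) * q ‖x‖) * φ x := by
        rw [lintegral_eq_lintegral_toSphere hd (by fun_prop), lintegral_lintegral_swap]
        · congr 1
          refine lintegral_congr fun u => setLIntegral_congr_fun measurableSet_Ioi fun r hr => ?_
          have hr : 0 < r := hr
          simp [norm_smul, abs_of_pos hr]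
        · fun_prop
    _ = _ := by
        rw [hσ, hσ', toSphere_volume_univ hd, toSphere_volume_univ hm, hcast,
          ← ENNReal.ofReal_inv_of_pos (by positivity), ← ENNReal.ofReal_mul (by positivity),
          ← lintegral_const_mul' _ _ ENNReal.ofReal_ne_top]
        refine lintegral_congr fun x => ?_
        rw [← mul_assoc, ← ENNReal.ofReal_mul (by positivity)]
        congr 2
        rw [hq, hK, radialDensity, pow_mul]
        simp only
        rw [Real.rpow_add Real.pi_pos]
        field_simp

/-! ### Negative binomial weights and the coefficients c_n -/

theorem negBinWeight_pos {r p : ℝ} (hr : 0 < r) (h0 : 0 < p) (h1 : p < 1) (n : ℕ) :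
    0 < negBinWeight r p n := by
  have := ringChoose_pos hr n
  have : 0 < 1 - p := by linarith
  unfold negBinWeight
  positivity

theorem tsum_ofReal_negBinWeight {r p : ℝ} (hr : 0 < r) (h0 : 0 < p) (h1 : p < 1) :
    ∑' n, ENNReal.ofReal (negBinWeight r p n) = 1 := by
  have h (n : ℕ) : ENNReal.ofReal (negBinWeight r p n) =
      ENNReal.ofReal (p ^ r) * ENNReal.ofReal (Ring.choose ((n : ℝ) + r - 1) n * (1 - p) ^ n) := by
    rw [← ENNReal.ofReal_mul (by positivity), negBinWeight]
    ring_nf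
  simp_rw [h]
  rw [ENNReal.tsum_mul_left, tsum_ofReal_ringChoose_mul_pow hr (by linarith) (by linarith),
    ← ENNReal.ofReal_mul (by positivity), sub_sub_cancel, ← Real.rpow_add h0]
  simp

theorem negBinMeasure_singleton (r p : ℝ) (n : ℕ) :
    negBinMeasure r p {n} = ENNReal.ofReal (negBinWeight r p n) := by
  rw [negBinMeasure, Measure.sum_apply _ (measurableSet_singleton n), tsum_eq_single n]
  · simp
  · intro k hk
    simp [hk]

theorem mul_one_sub_mem {t : ℝ} (h0 : 0 < t) (h1 : t < 1) : 0 < t * (1 - t) ∧ t * (1 - t) < 1 :=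
  ⟨by nlinarith, by nlinarith⟩

theorem measurable_negBinWeight (r : ℝ) (n : ℕ) :
    Measurable fun t : ℝ => negBinWeight r (t * (1 - t)) n := by
  unfold negBinWeight; fun_prop

theorem measurable_betaPDF_mul_negBinWeight (a b r : ℝ) (n : ℕ) : Measurable fun t : ℝ =>
    betaPDF a b t * ENNReal.ofReal (negBinWeight r (t * (1 - t)) n) :=
  (measurable_betaPDF a b).mul (measurable_negBinWeight r n).ennreal_ofReal

theorem betaPDFReal_eq_zero {a b t : ℝ} (h : t ∉ Set.Ioo (0 : ℝ) 1) : betaPDFReal a b t = 0 :=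
  if_neg h

theorem betaPDFReal_mul_negBinWeight_nonneg {d : ℕ} (hd : 0 < d) {ν μ : ℝ} (hν : 0 < ν)
    (hμ : 0 < μ) (n : ℕ) (t : ℝ) :
    0 ≤ betaPDFReal μ ν t * negBinWeight ((d : ℝ) / 2) (t * (1 - t)) n := by
  have hd' : (0 : ℝ) < d := by exact_mod_cast hd
  by_cases ht : t ∈ Set.Ioo (0 : ℝ) 1
  · exact (mul_pos (betaPDFReal_pos ht.1 ht.2 hμ hν) (negBinWeight_pos (by positivity)
      (mul_one_sub_mem ht.1 ht.2).1 (mul_one_sub_mem ht.1 ht.2).2 n)).le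
  · simp [betaPDFReal_eq_zero ht]

/-- Since 1-t+t² = 1-t(1-t), the power n is the factor (1-p)ⁿ for p = t(1-t). The extra exponents
d/2 make up p^(d/2), and what remains is the Beta(μ, ν) density, by symmetry of the Beta function.
-/
theorem mixCoeff_eq_integral (d : ℕ) (ν μ : ℝ) (n : ℕ) :
    mixCoeff d ν μ n =
      ∫ t, betaPDFReal μ ν t * negBinWeight ((d : ℝ) / 2) (t * (1 - t)) n := by
  rw [mixCoeff, intervalIntegral.integral_of_le zero_le_one, integral_Ioc_eq_integral_Ioo,
    ← integral_const_mul, ← setIntegral_eq_integral_of_forall_compl_eq_zero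
      (s := Set.Ioo (0 : ℝ) 1)
      (f := fun t => betaPDFReal μ ν t * negBinWeight ((d : ℝ) / 2) (t * (1 - t)) n)
      fun t ht => by simp only [betaPDFReal_eq_zero ht, zero_mul]]
  refine setIntegral_congr_fun measurableSet_Ioo fun t ht => ?_
  have h0 : 0 < t := ht.1
  have h1 : 0 < 1 - t := sub_pos.2 ht.2
  rw [betaPDFReal, if_pos ⟨h0, ht.2⟩, negBinWeight, ringChoose_eq_ascPochhammer,
    Real.mul_rpow h0.le h1.le, show 1 - t + t ^ 2 = 1 - t * (1 - t) by ring,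
    show μ + (d : ℝ) / 2 - 1 = (μ - 1) + (d : ℝ) / 2 by ring,
    show ν + (d : ℝ) / 2 - 1 = (ν - 1) + (d : ℝ) / 2 by ring,
    Real.rpow_add h0, Real.rpow_add h1, beta, beta, add_comm μ ν,
    mul_comm (Real.Gamma μ) (Real.Gamma ν)]
  ring

theorem tsum_lintegral_betaPDF_mul_negBinWeight {d : ℕ} (hd : 0 < d) {ν μ : ℝ} (hν : 0 < ν)
    (hμ : 0 < μ) :
    ∑' n, ∫⁻ t, betaPDF μ ν t * ENNReal.ofReal (negBinWeight ((d : ℝ) / 2) (t * (1 - t)) n) =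
      1 := by
  have hd' : (0 : ℝ) < d := by exact_mod_cast hd
  rw [← lintegral_tsum fun n => (measurable_betaPDF_mul_negBinWeight μ ν _ n).aemeasurable,
    ← lintegral_betaPDF_eq_one hμ hν]
  refine lintegral_congr fun t => ?_
  rcases le_or_gt t 0 with ht0 | ht0
  · simp [betaPDF_eq_zero_of_nonpos ht0]
  rcases le_or_gt 1 t with ht1 | ht1
  · simp [betaPDF_eq_zero_of_one_le ht1]
  have ht := mul_one_sub_mem ht0 ht1
  rw [ENNReal.tsum_mul_left, tsum_ofReal_negBinWeight (by positivity) ht.1 ht.2, mul_one]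

theorem ofReal_betaPDFReal_mul_negBinWeight {ν μ : ℝ} (hν : 0 < ν) (hμ : 0 < μ) (r : ℝ) (n : ℕ)
    (t : ℝ) :
    ENNReal.ofReal (betaPDFReal μ ν t * negBinWeight r (t * (1 - t)) n) =
      betaPDF μ ν t * ENNReal.ofReal (negBinWeight r (t * (1 - t)) n) := by
  refine ENNReal.ofReal_mul ?_
  by_cases ht : t ∈ Set.Ioo (0 : ℝ) 1
  · exact (betaPDFReal_pos ht.1 ht.2 hμ hν).le
  · rw [betaPDFReal_eq_zero ht]

/-- Each integral is one term of a series of nonnegative terms with sum 1, hence finite. -/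
theorem integrable_betaPDFReal_mul_negBinWeight {d : ℕ} (hd : 0 < d) {ν μ : ℝ} (hν : 0 < ν)
    (hμ : 0 < μ) (n : ℕ) :
    Integrable fun t => betaPDFReal μ ν t * negBinWeight ((d : ℝ) / 2) (t * (1 - t)) n := by
  refine ⟨((measurable_betaPDFReal μ ν).mul (measurable_negBinWeight _ n)).aestronglyMeasurable, ?_⟩
  rw [hasFiniteIntegral_iff_ofReal (Filter.Eventually.of_forall
    (betaPDFReal_mul_negBinWeight_nonneg hd hν hμ n))]
  simp_rw [ofReal_betaPDFReal_mul_negBinWeight hν hμ]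
  refine (ENNReal.le_tsum (f := fun n => ∫⁻ t, betaPDF μ ν t *
    ENNReal.ofReal (negBinWeight ((d : ℝ) / 2) (t * (1 - t)) n)) n).trans_lt ?_
  rw [tsum_lintegral_betaPDF_mul_negBinWeight hd hν hμ]
  exact ENNReal.one_lt_top

theorem ofReal_mixCoeff {d : ℕ} (hd : 0 < d) {ν μ : ℝ} (hν : 0 < ν) (hμ : 0 < μ) (n : ℕ) :
    ENNReal.ofReal (mixCoeff d ν μ n) =
      ∫⁻ t, betaPDF μ ν t * ENNReal.ofReal (negBinWeight ((d : ℝ) / 2) (t * (1 - t)) n) := by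
  rw [mixCoeff_eq_integral, ofReal_integral_eq_lintegral_ofReal
    (integrable_betaPDFReal_mul_negBinWeight hd hν hμ n) (Filter.Eventually.of_forall
    (betaPDFReal_mul_negBinWeight_nonneg hd hν hμ n))]
  exact lintegral_congr fun t => ofReal_betaPDFReal_mul_negBinWeight hν hμ _ n t

theorem mixCoeff_pos {d : ℕ} (hd : 0 < d) {ν μ : ℝ} (hν : 0 < ν) (hμ : 0 < μ) (n : ℕ) :
    0 < mixCoeff d ν μ n := by
  have hd' : (0 : ℝ) < d := by exact_mod_cast hd
  rw [mixCoeff_eq_integral, integral_pos_iff_support_of_nonneg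
    (betaPDFReal_mul_negBinWeight_nonneg hd hν hμ n)
    (integrable_betaPDFReal_mul_negBinWeight hd hν hμ n)]
  refine lt_of_lt_of_le ?_ (measure_mono (s := Set.Ioo (0 : ℝ) 1) fun t ht => ?_)
  · simp
  · exact (mul_pos (betaPDFReal_pos ht.1 ht.2 hμ hν) (negBinWeight_pos (by positivity)
      (mul_one_sub_mem ht.1 ht.2).1 (mul_one_sub_mem ht.1 ht.2).2 n)).ne'

theorem tsum_ofReal_mixCoeff {d : ℕ} (hd : 0 < d) {ν μ : ℝ} (hν : 0 < ν) (hμ : 0 < μ) :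
    ∑' n, ENNReal.ofReal (mixCoeff d ν μ n) = 1 := by
  simp_rw [ofReal_mixCoeff hd hν hμ]
  exact tsum_lintegral_betaPDF_mul_negBinWeight hd hν hμ

theorem hasSum_mixCoeff {d : ℕ} (hd : 0 < d) {ν μ : ℝ} (hν : 0 < ν) (hμ : 0 < μ) :
    HasSum (mixCoeff d ν μ) 1 := by
  have h1 := tsum_ofReal_mixCoeff hd hν hμ
  have h := ENNReal.hasSum_toReal (f := fun n => ENNReal.ofReal (mixCoeff d ν μ n))
    (by rw [h1]; exact ENNReal.one_ne_top)
  simp_rw [ENNReal.toReal_ofReal (mixCoeff_pos hd hν hμ _).le] at h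
  have h2 := congrArg ENNReal.toReal h1
  rw [ENNReal.tsum_toReal_eq fun n => ENNReal.ofReal_ne_top] at h2
  simp_rw [ENNReal.toReal_ofReal (mixCoeff_pos hd hν hμ _).le] at h2
  rwa [h2, ENNReal.toReal_one] at h

theorem compoundNegBin_singleton {d : ℕ} (hd : 0 < d) {ν μ : ℝ} (hν : 0 < ν) (hμ : 0 < μ)
    (n : ℕ) :
    compoundNegBin ((d : ℝ) / 2) (fun t => t * (1 - t)) (betaMeasure μ ν) {n} =
      ENNReal.ofReal (mixCoeff d ν μ n) := by
  have hw : Measurable fun t : ℝ =>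
      ENNReal.ofReal (negBinWeight ((d : ℝ) / 2) (t * (1 - t)) n) :=
    (measurable_negBinWeight _ n).ennreal_ofReal
  have hm : Measurable fun t : ℝ => negBinMeasure ((d : ℝ) / 2) (t * (1 - t)) :=
    (measurable_negBinMeasure _).comp (by fun_prop)
  rw [compoundNegBin, Measure.bind_apply (measurableSet_singleton n) hm.aemeasurable,
    ofReal_mixCoeff hd hν hμ, betaMeasure]
  simp_rw [negBinMeasure_singleton]
  exact lintegral_withDensity_eq_lintegral_mul _ (measurable_betaPDF μ ν) hw

theorem isProbabilityMeasure_compoundNegBin {d : ℕ} (hd : 0 < d) {ν μ : ℝ} (hν : 0 < ν)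
    (hμ : 0 < μ) : IsProbabilityMeasure
      (compoundNegBin ((d : ℝ) / 2) (fun t => t * (1 - t)) (betaMeasure μ ν)) := by
  refine ⟨?_⟩
  rw [← tsum_ofReal_mixCoeff hd hν hμ, ← Set.iUnion_of_singleton ℕ,
    measure_iUnion (fun i j hij => by simpa using hij) fun n => measurableSet_singleton n]
  simp_rw [compoundNegBin_singleton hd hν hμ]

/-! ### Expansion of the convolution in radial densities -/

theorem tsum_negBinWeight_mul_radialDensity {d : ℕ} (hd : 0 < d) {η p : ℝ} (hη : 0 < η)
    (h0 : 0 < p) (h1 : p < 1) (x : Euc d) :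
    ∑' n, ENNReal.ofReal (negBinWeight ((d : ℝ) / 2) p n) *
        ENNReal.ofReal (radialDensity d n η x) =
      ENNReal.ofReal (Real.Gamma (η + (d : ℝ) / 2) / (Real.Gamma η * Real.pi ^ ((d : ℝ) / 2)) *
        (p ^ ((d : ℝ) / 2) * (1 + p * ‖x‖ ^ 2) ^ (-η - (d : ℝ) / 2))) := by
  have hd' : (0 : ℝ) < (d : ℝ) / 2 := by positivity
  set h : ℝ := (d : ℝ) / 2 with hh
  set R : ℝ := ‖x‖ ^ 2 with hR
  have hR0 : 0 ≤ R := by positivity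
  have hp : 0 < 1 - p := by linarith
  have hG := Real.Gamma_pos_of_pos hη
  have hG1 := Real.Gamma_pos_of_pos (show 0 < η + h by positivity)
  have hGh := Real.Gamma_pos_of_pos hd'
  set A : ℝ := Real.Gamma (η + h) / (Real.Gamma η * Real.pi ^ h) *
    (p ^ h * (1 + R) ^ (-(η + h))) with hA
  -- This `z` is chosen so that 1 + pR = (1 + R)(1 - z). In each product of a weight and a radial
  -- density, Γ(h) and Γ(h+n) cancel, leaving the coefficient of zⁿ in (1-z)^(-(η+h)).
  set z : ℝ := (1 - p) * (R / (1 + R)) with hz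
  have hz0 : 0 ≤ z := by positivity
  have hz1 : 1 - z = (1 + p * R) / (1 + R) := by rw [hz]; field_simp; ring
  have hz2 : z < 1 := by
    have : 0 < 1 - z := by rw [hz1]; positivity
    linarith
  have key (n : ℕ) : ENNReal.ofReal (negBinWeight h p n) *
      ENNReal.ofReal (radialDensity d n η x) =
      ENNReal.ofReal A * ENNReal.ofReal (Ring.choose ((n : ℝ) + (η + h) - 1) n * z ^ n) := by
    rw [← ENNReal.ofReal_mul (negBinWeight_pos hd' h0 h1 n).le,
      ← ENNReal.ofReal_mul (by positivity)]
    congr 1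
    have hGn := Real.Gamma_pos_of_pos (show 0 < h + n by positivity)
    rw [negBinWeight, radialDensity, ← hh, ← hR, ringChoose_eq_Gamma hd',
      ringChoose_eq_Gamma (show 0 < η + h by positivity), hA, hz,
      show -(η + h + n) = -(η + h) + -(n : ℝ) by ring, Real.rpow_add (by positivity),
      Real.rpow_neg (by positivity) (n : ℝ), Real.rpow_natCast, mul_pow, div_pow]
    field_simp
  simp_rw [key]
  rw [ENNReal.tsum_mul_left, tsum_ofReal_ringChoose_mul_pow (by positivity) hz0 hz2, hz1,
    ← ENNReal.ofReal_mul (by positivity), hA, Real.div_rpow (by positivity) (by positivity),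
    show -η - h = -(η + h) by ring]
  congr 1
  have : 0 < (1 + R) ^ (-(η + h)) := by positivity
  field_simp

/-- Each c_n is a Beta average of negative binomial weights, so by Tonelli the sum over n is taken
inside the integral over t. The density with parameter `μ` comes first to produce the Beta(μ, ν)
order. -/
theorem tsum_mixCoeff_mul_radialDensity {d : ℕ} (hd : 0 < d) {ν μ : ℝ} (hν : 0 < ν) (hμ : 0 < μ)
    (x : Euc d) :
    ∑' n, ENNReal.ofReal (mixCoeff d ν μ n) * ENNReal.ofReal (radialDensity d n (ν + μ) x) =
      lconvolution (fun x : Euc d => ENNReal.ofReal (studentDensity d μ x))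
        (fun x => ENNReal.ofReal (studentDensity d ν x)) volume x := by
  have hm := measurable_betaPDF_mul_negBinWeight μ ν ((d : ℝ) / 2)
  rw [lconvolution_studentDensity d hμ hν]
  simp_rw [ofReal_mixCoeff hd hν hμ, ← lintegral_mul_const _ (hm _)]
  rw [← lintegral_tsum fun n => ((hm n).mul_const _).aemeasurable]
  refine lintegral_congr fun t => ?_
  rcases le_or_gt t 0 with ht0 | ht0
  · simp [betaPDF_eq_zero_of_nonpos ht0]
  rcases le_or_gt 1 t with ht1 | ht1
  · simp [betaPDF_eq_zero_of_one_le ht1]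
  have ht := mul_one_sub_mem ht0 ht1
  simp_rw [mul_assoc]
  rw [ENNReal.tsum_mul_left, tsum_negBinWeight_mul_radialDensity hd (add_pos hν hμ) ht.1 ht.2,
    add_comm ν μ]
  simp_rw [mul_assoc]

/-! ### Existence of the variables -/

theorem exists_isMixtureData {d : ℕ} (hd : 0 < d) {ν μ : ℝ} (hν : 0 < ν) (hμ : 0 < μ) :
    ∃ (Ω' : Type) (_ : MeasurableSpace Ω') (P' : Measure Ω') (_ : IsProbabilityMeasure P')
      (N : Ω' → ℕ) (T : (n : ℕ) → Ω' → Euc (2 * n + d))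
      (U : Ω' → Metric.sphere (0 : Euc d) 1), IsMixtureData d ν μ P' N T U := by
  have := isProbabilityMeasure_compoundNegBin hd hν hμ
  have := isProbabilityMeasure_uniformSphere hd
  have (n : ℕ) := isProbabilityMeasure_studentMeasure (2 * n + d) (add_pos hν hμ)
  set κ := compoundNegBin ((d : ℝ) / 2) (fun t => t * (1 - t)) (betaMeasure μ ν) with hκ
  -- The conditions do not constrain the joint law of the T_{2n+d} for different n; the product
  -- measure is one admissible choice.
  set τ := Measure.infinitePi fun n : ℕ => studentMeasure (2 * n + d) (ν + μ)
  have hT (n : ℕ) : MeasurePreserving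
      (fun ω : ℕ × ((∀ n : ℕ, Euc (2 * n + d)) × Metric.sphere (0 : Euc d) 1) => ω.2.1 n)
      (κ.prod (τ.prod (uniformSphere d))) (studentMeasure (2 * n + d) (ν + μ)) :=
    (measurePreserving_eval_infinitePi _ n).comp
      (measurePreserving_fst.comp measurePreserving_snd)
  have hU : MeasurePreserving
      (fun ω : ℕ × ((∀ n : ℕ, Euc (2 * n + d)) × Metric.sphere (0 : Euc d) 1) => ω.2.2)
      (κ.prod (τ.prod (uniformSphere d))) (uniformSphere d) :=
    measurePreserving_snd.comp measurePreserving_snd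
  refine ⟨ℕ × ((∀ n : ℕ, Euc (2 * n + d)) × Metric.sphere (0 : Euc d) 1), inferInstance,
    κ.prod (τ.prod (uniformSphere d)), inferInstance, fun ω => ω.1, fun n ω => ω.2.1 n,
    fun ω => ω.2.2, ⟨by fun_prop, fun n => ?_, fun n => (hT n).hasLaw, hU.hasLaw, fun n => ?_,
      fun n => ?_⟩⟩
  · have h := (measurePreserving_fst (μ := κ) (ν := τ.prod (uniformSphere d))).measure_preimage
      (measurableSet_singleton n).nullMeasurableSet
    rw [hκ, compoundNegBin_singleton hd hν hμ] at h
    exact (congrArg ENNReal.toReal h).trans (ENNReal.toReal_ofReal (mixCoeff_pos hd hν hμ n).le)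
  · rw [indepFun_iff_map_prod_eq_prod_map_map (hT n).measurable.aemeasurable
      hU.measurable.aemeasurable, (hT n).map_eq, hU.map_eq]
    exact (((measurePreserving_eval_infinitePi _ n).prod (MeasurePreserving.id _)).comp
      measurePreserving_snd).map_eq
  · exact indepFun_prod (X := fun k : ℕ => k)
      (Y := fun ω : (∀ n : ℕ, Euc (2 * n + d)) × Metric.sphere (0 : Euc d) 1 => (ω.1 n, ω.2))
      measurable_id (by fun_prop)

/-! ### The law of ‖T_{2N+d}‖U_d -/

namespace IsMixtureData

variable {d : ℕ} {ν μ : ℝ} {Ω : Type*} [MeasurableSpace Ω] {P : Measure Ω}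
  {N : Ω → ℕ} {T : (n : ℕ) → Ω → Euc (2 * n + d)} {U : Ω → Metric.sphere (0 : Euc d) 1}

theorem measure_index [IsProbabilityMeasure P] (h : IsMixtureData d ν μ P N T U) (n : ℕ) :
    P (N ⁻¹' {n}) = ENNReal.ofReal (mixCoeff d ν μ n) := by
  rw [← h.prob_index n, ofReal_measureReal]
  rfl

theorem hasLaw_index [IsProbabilityMeasure P] (h : IsMixtureData d ν μ P N T U) (hd : 0 < d)
    (hν : 0 < ν) (hμ : 0 < μ) :
    HasLaw N (compoundNegBin ((d : ℝ) / 2) (fun t => t * (1 - t)) (betaMeasure μ ν)) P where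
  aemeasurable := h.aemeasurable_index
  map_eq := by
    refine Measure.ext_of_singleton fun n => ?_
    rw [Measure.map_apply_of_aemeasurable h.aemeasurable_index (measurableSet_singleton n),
      h.measure_index, compoundNegBin_singleton hd hν hμ]

theorem hasLaw_norm_smul [IsProbabilityMeasure P] (h : IsMixtureData d ν μ P N T U) (hd : 0 < d)
    (hη : 0 < ν + μ) (n : ℕ) :
    HasLaw (fun ω => ‖T n ω‖ • (U ω : Euc d))
      (volume.withDensity fun x => ENNReal.ofReal (radialDensity d n (ν + μ) x)) P := by
  have := isProbabilityMeasure_uniformSphere hd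
  have hT := (h.law_student n).aemeasurable
  have hU := h.law_sphere.aemeasurable
  have hg : Measurable fun p : Euc (2 * n + d) × Metric.sphere (0 : Euc d) 1 =>
      ‖p.1‖ • (p.2 : Euc d) := by fun_prop
  have hX : AEMeasurable (fun ω => ‖T n ω‖ • (U ω : Euc d)) P :=
    hT.norm.smul (measurable_subtype_coe.comp_aemeasurable hU)
  refine ⟨hX, ?_⟩
  refine Measure.ext_of_lintegral _ fun φ hφ => ?_
  have hφg : Measurable fun p : Euc (2 * n + d) × Metric.sphere (0 : Euc d) 1 =>
      φ (‖p.1‖ • (p.2 : Euc d)) := hφ.comp hg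
  have h1 := lintegral_map' hφg.aemeasurable (hT.prodMk hU)
  rw [(h.indep_student_sphere n).map_prod_eq_prod_map_map hT hU, (h.law_student n).map_eq,
    h.law_sphere.map_eq, lintegral_prod _ hφg.aemeasurable] at h1
  dsimp only at h1
  rw [lintegral_map' hφ.aemeasurable hX,
    lintegral_withDensity_eq_lintegral_mul _ (measurable_radialDensity d n _).ennreal_ofReal hφ]
  exact h1.symm.trans (lintegral_studentMeasure_uniformSphere hd n hη hφ)

/-- As N takes countably many values, all T_{2n+d} can be replaced by measurable versions off a
single null set, and evaluation at the random index N is then measurable. -/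
theorem aemeasurable_norm_smul (h : IsMixtureData d ν μ P N T U) :
    AEMeasurable (fun ω => ‖T (N ω) ω‖ • (U ω : Euc d)) P := by
  have hT (n : ℕ) := (h.law_student n).aemeasurable
  have hU := h.law_sphere.aemeasurable
  have hN := h.aemeasurable_index
  have hm : Measurable fun p : Ω × ℕ => ‖(hT p.2).mk _ p.1‖ • (hU.mk _ p.1 : Euc d) :=
    measurable_from_prod_countable_left fun n => (hT n).measurable_mk.norm.smul
      (measurable_subtype_coe.comp hU.measurable_mk)
  have hm' := hm.comp (measurable_id.prodMk hN.measurable_mk)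
  refine ⟨_, hm', ?_⟩
  filter_upwards [ae_all_iff.2 fun n => (hT n).ae_eq_mk, hU.ae_eq_mk, hN.ae_eq_mk]
    with ω h1 h2 h3
  simp only [Function.comp_apply, id_eq]
  rw [← h2, ← h3, ← h1]

/-- Split according to the value of N. On {N = n} the vector is ‖T_{2n+d}‖U_d, which is independent
of N, so each piece contributes c_n times its radial law. -/
theorem hasLaw_mixture [IsProbabilityMeasure P] (h : IsMixtureData d ν μ P N T U) (hd : 0 < d)
    (hη : 0 < ν + μ) :
    HasLaw (fun ω => ‖T (N ω) ω‖ • (U ω : Euc d))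
      (volume.withDensity fun x => ∑' n,
        ENNReal.ofReal (mixCoeff d ν μ n) * ENNReal.ofReal (radialDensity d n (ν + μ) x)) P := by
  refine ⟨h.aemeasurable_norm_smul, Measure.ext fun s hs => ?_⟩
  have hN := h.aemeasurable_index
  have hX (n : ℕ) := h.hasLaw_norm_smul hd hη n
  have hr (n : ℕ) := (measurable_radialDensity d n (ν + μ)).ennreal_ofReal
  have hunion : (fun ω => ‖T (N ω) ω‖ • (U ω : Euc d)) ⁻¹' s =
      ⋃ n, N ⁻¹' {n} ∩ (fun ω => ‖T n ω‖ • (U ω : Euc d)) ⁻¹' s := by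
    ext ω; simp
  -- The variables are only a.e. measurable, so the pieces are null-measurable and the a.e. form of
  -- countable additivity is needed.
  have hdisj : Pairwise (Function.onFun (AEDisjoint P) fun n =>
      N ⁻¹' {n} ∩ (fun ω => ‖T n ω‖ • (U ω : Euc d)) ⁻¹' s) := fun i j hij =>
    Disjoint.aedisjoint (Set.disjoint_left.2 fun ω h1 h2 => hij (h1.1.symm.trans h2.1))
  rw [Measure.map_apply_of_aemeasurable h.aemeasurable_norm_smul hs, hunion,
    measure_iUnion₀ hdisj fun n => (hN.nullMeasurableSet_preimage (measurableSet_singleton n)).inter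
      ((hX n).aemeasurable.nullMeasurableSet_preimage hs), withDensity_apply _ hs,
    lintegral_tsum fun n => ((hr n).const_mul _).aemeasurable]
  refine tsum_congr fun n => ?_
  have hg : Measurable fun p : Euc (2 * n + d) × Metric.sphere (0 : Euc d) 1 =>
      ‖p.1‖ • (p.2 : Euc d) := by fun_prop
  have hind : IndepFun N (fun ω => ‖T n ω‖ • (U ω : Euc d)) P :=
    (h.indep_index n).comp measurable_id hg
  rw [hind.measure_inter_preimage_eq_mul _ _ (measurableSet_singleton n) hs, h.measure_index,
    lintegral_const_mul _ (hr n), ← withDensity_apply _ hs, ← (hX n).map_eq,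
    Measure.map_apply_of_aemeasurable (hX n).aemeasurable hs]

end IsMixtureData

theorem mainTheorem4 {d : ℕ} (hd : 0 < d) {ν μ : ℝ} (hν : 0 < ν) (hμ : 0 < μ)
    {Ω : Type*} [MeasurableSpace Ω] (P : Measure Ω) [IsProbabilityMeasure P]
    (T₁ T₂ : Ω → Euc d)
    (hT₁ : HasLaw T₁ (studentMeasure d ν) P) (hT₂ : HasLaw T₂ (studentMeasure d μ) P)
    (hT : IndepFun T₁ T₂ P) :
    -- the coefficients define a probability distribution on the non-negative integers
    ((∀ n : ℕ, 0 < mixCoeff d ν μ n) ∧ HasSum (mixCoeff d ν μ) 1) ∧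
    -- variables as in the representation exist
    (∃ (Ω' : Type) (_ : MeasurableSpace Ω') (P' : Measure Ω') (_ : IsProbabilityMeasure P')
      (N : Ω' → ℕ) (T : (n : ℕ) → Ω' → Euc (2 * n + d))
      (U : Ω' → Metric.sphere (0 : Euc d) 1), IsMixtureData d ν μ P' N T U) ∧
    -- for all such variables, `T₁ + T₂` is distributed as `‖T_{2N+d}‖ U_d`, and `N` is compound
    -- negative binomial with a Beta distributed parameter
    (∀ (Ω' : Type*) [MeasurableSpace Ω'] (P' : Measure Ω') [IsProbabilityMeasure P']
      (N : Ω' → ℕ) (T : (n : ℕ) → Ω' → Euc (2 * n + d))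
      (U : Ω' → Metric.sphere (0 : Euc d) 1), IsMixtureData d ν μ P' N T U →
        IdentDistrib (fun ω => T₁ ω + T₂ ω)
          (fun ω => ‖T (N ω) ω‖ • (U ω : Euc d)) P P' ∧
        HasLaw N
          (compoundNegBin ((d : ℝ) / 2) (fun t => t * (1 - t)) (betaMeasure μ ν)) P') := by

  refine ⟨⟨mixCoeff_pos hd hν hμ, hasSum_mixCoeff hd hν hμ⟩, exists_isMixtureData hd hν hμ,
    fun Ω' _ P' _ N T U h => ⟨?_, h.hasLaw_index hd hν hμ⟩⟩
  have := isProbabilityMeasure_studentMeasure d hν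
  have := isProbabilityMeasure_studentMeasure d hμ
  -- The sum is taken as T₂ + T₁, so that the convolution has the parameter order (μ, ν) of the Beta
  -- law.
  have hsum := hT.symm.hasLaw_fun_add hT₂ hT₁
  have hmix := h.hasLaw_mixture hd (add_pos hν hμ)
  simp_rw [add_comm (T₁ _)]
  refine ⟨hsum.aemeasurable, hmix.aemeasurable, ?_⟩
  rw [hsum.map_eq, hmix.map_eq, studentMeasure, studentMeasure,
    conv_withDensity_eq_lconvolution (measurable_studentDensity d μ).ennreal_ofReal
      (measurable_studentDensity d ν).ennreal_ofReal]
  congr 1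
  exact funext fun x => (tsum_mixCoeff_mul_radialDensity hd hν hμ x).symm
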